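/- Let $G$ be a finite group and let $T$ be a $G$-Tambara functor, that is, a product-preserving functor from the category of bispans of finite $G$-sets to sets such that every $T(X)$ is a commutative ring under the induced semiring structure. A \emph{Tambara ideal} $I$ of $T$ is a family of ideals $I(G/H)\subseteq T(G/H)$, one for each subgroup $H\le G$, that is closed under all the restriction, transfer, norm and conjugation maps $\mathrm{res}^K_H$, $\mathrm{tr}_H^K$, $\mathrm{nm}_H^K$ ($H\le K\le G$) and $c_{g,H}\colon T(G/H)\to T(G/gHg^{-1})$ ($g \in G$). The product $IJ$ of two Tambara ideals is the smallest Tambara ideal containing $I(G/H)\cdot J(G/H)$ for all $H\le G$, and a Tambara ideal $\mathfrak p\neq T$ is \emph{prime} if $IJ\subseteq\mathfrak p$ implies $I\subseteq\mathfrak p$ or $J\subseteq\mathfrak p$, for all Tambara ideals $I,J$ of $T$. Let $\mathrm{nil}(T)$ be the intersection of all prime Tambara ideals of $T$ (all of $T$ if there are none), and let $N(T)$ be the levelwise nilradical, i.e. $N(T)(G/H)$ is the nilradical of the ring $T(G/H)$ for every $H\le G$. Then $\mathrm{nil}(T)=N(T)$, i.e. $\mathrm{nil}(T)(G/H)=N(T)(G/H)$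 for every $H\le G$. So an element $x\in T(G/H)$ lies in $\mathfrak p(G/H)$ for every prime Tambara ideal $\mathfrak p$ of $T$ if and only if $x$ is nilpotent in the ring $T(G/H)$. In particular, $N(T)$ is a Tambara ideal. -/

import Mathlib

universe u v

namespace Tambara

/-! ### Finite `G`-sets: sums, fibre products and dependent products

A finite `G`-set is a type with `[MulAction G X]` and `[Finite X]`; its morphisms are the
equivariant maps `X →[G] Y`. -/

section GSets

variable {G : Type u} [Group G]

/-- The left inclusion `X → X ⨿ Y`. -/
def inlHom (G : Type u) [Group G] (X Y : Type u) [MulAction G X] [MulAction G Y] :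
    X →[G] (X ⊕ Y) where
  toFun := Sum.inl
  map_smul' _ _ := rfl

/-- The right inclusion `Y → X ⨿ Y`. -/
def inrHom (G : Type u) [Group G] (X Y : Type u) [MulAction G X] [MulAction G Y] :
    Y →[G] (X ⊕ Y) where
  toFun := Sum.inr
  map_smul' _ _ := rfl

/-- The fold map `∇ : X ⨿ X → X`. -/
def foldHom (G : Type u) [Group G] (X : Type u) [MulAction G X] : (X ⊕ X) →[G] X where
  toFun := Sum.elim id id
  map_smul' _ x := by cases x <;> rfl

/-- The square
```
  P --f'--> X'
  |         |
  g'        g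
  v         v
  X --f---> Y
```
is a pullback square of `G`-sets. -/
def IsPullbackSquare {P X X' Y : Type u} [MulAction G P] [MulAction G X] [MulAction G X']
    [MulAction G Y] (g' : P →[G] X) (f' : P →[G] X') (f : X →[G] Y) (g : X' →[G] Y) : Prop :=
  (∀ p, f (g' p) = g (f' p)) ∧ ∀ x x', f x = g x' → ∃! p, g' p = x ∧ f' p = x'

/-- The dependent product `Π_f g` along `f : Y → Z` of `g : X → Y`: its points over `z : Z` are
the (not necessarily equivariant) sections of `g` over the fibre `f ⁻¹ {z}`. -/
structure DepProd {X Y Z : Type u} [MulAction G X] [MulAction G Y] [MulAction G Z]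
    (f : Y →[G] Z) (g : X →[G] Y) : Type u where
  base : Z
  sec : {y : Y // f y = base} → X
  is_section : ∀ y, g (sec y) = y

/-- The domain of the pulled back map: the fibre product `Y ×_Z Π_f g`. -/
@[ext]
structure DepProdPull {X Y Z : Type u} [MulAction G X] [MulAction G Y] [MulAction G Z]
    (f : Y →[G] Z) (g : X →[G] Y) : Type u where
  point : Y
  elt : DepProd f g
  comm : f point = elt.base

section DepProd

variable {X Y Z : Type u} [MulAction G X] [MulAction G Y] [MulAction G Z]
  (f : Y →[G] Z) (g : X →[G] Y)

theorem DepProd.ext' {f : Y →[G] Z} {g : X →[G] Y} {a b : DepProd f g} (h : a.base = b.base)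
    (h' : ∀ (y : Y) (ha : f y = a.base) (hb : f y = b.base), a.sec ⟨y, ha⟩ = b.sec ⟨y, hb⟩) :
    a = b := by
  obtain ⟨z, s, hs⟩ := a
  obtain ⟨z', s', hs'⟩ := b
  dsimp only at h
  subst h
  have : s = s' := funext fun y => h' y.1 y.2 y.2
  subst this
  rfl

/-- `G` acts on the sections by conjugation: `(γ • s)(y) = γ • s (γ⁻¹ • y)`. -/
instance : SMul G (DepProd f g) where
  smul γ a :=
    { base := γ • a.base
      sec := fun y => γ • a.sec ⟨γ⁻¹ • y.1, by rw [map_smul, y.2, inv_smul_smul]⟩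
      is_section := fun y => by rw [map_smul, a.is_section, smul_inv_smul] }

theorem DepProd.smul_sec (γ : G) (a : DepProd f g) (y : {y : Y // f y = (γ • a).base})
    (y' : {y : Y // f y = a.base}) (h : γ⁻¹ • y.1 = y'.1) : (γ • a).sec y = γ • a.sec y' := by
  exact congrArg (fun t => γ • a.sec t) (Subtype.ext h)

instance : MulAction G (DepProd f g) where
  one_smul a := DepProd.ext' (one_smul G a.base) fun y ha hb => by
    rw [DepProd.smul_sec f g 1 a ⟨y, ha⟩ ⟨y, hb⟩ (by simp), one_smul]
  mul_smul γ δ a := DepProd.ext' (mul_smul γ δ a.base) fun y ha hb => by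
    have h1 : f (γ⁻¹ • y) = (δ • a).base := by
      rw [map_smul, hb]
      exact inv_smul_smul γ (δ • a.base)
    have h2 : f (δ⁻¹ • γ⁻¹ • y) = a.base := by
      rw [map_smul, h1]
      exact inv_smul_smul δ a.base
    rw [DepProd.smul_sec f g (γ * δ) a ⟨y, ha⟩ ⟨_, h2⟩ (by simp [mul_smul]),
      DepProd.smul_sec f g γ (δ • a) ⟨y, hb⟩ ⟨_, h1⟩ rfl,
      DepProd.smul_sec f g δ a ⟨_, h1⟩ ⟨_, h2⟩ rfl, mul_smul]

instance [Finite X] [Finite Y] [Finite Z] : Finite (DepProd f g) :=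
  Finite.of_injective
    (fun a : DepProd f g =>
      (⟨a.base, a.sec⟩ : Σ z : Z, ({y : Y // f y = z} → X)))
    (fun a b h => by
      obtain ⟨z, s, hs⟩ := a
      obtain ⟨z', s', hs'⟩ := b
      simp only [Sigma.mk.injEq] at h
      obtain ⟨h1, h2⟩ := h
      subst h1
      cases h2
      rfl)

instance : MulAction G (DepProdPull f g) where
  smul γ e := ⟨γ • e.point, γ • e.elt, by rw [map_smul, e.comm]; rfl⟩
  one_smul e := DepProdPull.ext (one_smul G e.point) (one_smul G e.elt)
  mul_smul γ δ e := DepProdPull.ext (mul_smul γ δ e.point) (mul_smul γ δ e.elt)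

instance [Finite X] [Finite Y] [Finite Z] : Finite (DepProdPull f g) :=
  Finite.of_injective (fun e : DepProdPull f g => (e.point, e.elt))
    (fun _ _ h => DepProdPull.ext (congrArg Prod.fst h) (congrArg Prod.snd h))

/-- The structure map `Π_f g → Z`. -/
def depProdHom : DepProd f g →[G] Z where
  toFun a := a.base
  map_smul' _ _ := rfl

/-- The pullback `f' : Y ×_Z Π_f g → Π_f g` of `f`. -/
def depProdPullHom : DepProdPull f g →[G] DepProd f g where
  toFun e := e.elt
  map_smul' _ _ := rfl

/-- The counit `ε : Y ×_Z Π_f g → X`, evaluation of sections. -/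
def depProdEval : DepProdPull f g →[G] X where
  toFun e := e.elt.sec ⟨e.point, e.comm⟩
  map_smul' γ e := DepProd.smul_sec f g γ e.elt _ _ (inv_smul_smul γ e.point)

end DepProd

/-- The canonical quotient map `G/H → G/K`, `xH ↦ xK`, for `H ≤ K`. -/
def quotHom {H K : Subgroup G} (h : H ≤ K) : (G ⧸ H) →[G] (G ⧸ K) where
  toFun := Subgroup.quotientMapOfLE h
  map_smul' γ x := by
    induction x using QuotientGroup.induction_on
    rfl

/-- The conjugate subgroup `gHg⁻¹`. -/
def conjSubgroup (g : G) (H : Subgroup G) : Subgroup G :=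
  H.map (MulAut.conj g).toMonoidHom

/-- The canonical isomorphism `G/H → G/gHg⁻¹`, `xH ↦ xg⁻¹(gHg⁻¹)`. -/
def conjHom (g : G) (H : Subgroup G) : (G ⧸ H) →[G] (G ⧸ conjSubgroup g H) where
  toFun := Quotient.map' (fun x => x * g⁻¹) (by
    intro x y hxy
    rw [QuotientGroup.leftRel_apply] at hxy ⊢
    exact ⟨x⁻¹ * y, hxy, by simp [mul_assoc]⟩)
  map_smul' γ x := by
    induction x using QuotientGroup.induction_on with
    | H x =>
      change ((γ * x * g⁻¹ : G) : G ⧸ conjSubgroup g H) = ((γ * (x * g⁻¹) : G) : _)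
      rw [mul_assoc]

end GSets

/-! ### Tambara functors -/

/-- A `G`-Tambara functor: a product-preserving functor from the category `𝒫_G` of bispans of
finite `G`-sets to sets, all of whose values are rings.

The category `𝒫_G` is generated by the morphisms `T_f`, `N_f`, `R_f`, with relations the
functoriality of `T`, `N`, `R`, the two pullback rules, and the rule for `N_f ∘ T_g` coming from
exponential diagrams; a functor on `𝒫_G` is thus given by functions `tr f`, `nm f`, `res f`
satisfying these rules. The last four fields say that the ring structure on `obj X` is
the one induced by the semiring object `X` of `𝒫_G`. -/
structure TambaraFunctor (G : Type u) [Group G] where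
  obj : (X : Type u) → [MulAction G X] → [Finite X] → Type v
  [ring : (X : Type u) → [MulAction G X] → [Finite X] → CommRing (obj X)]
  tr : {X Y : Type u} → [MulAction G X] → [Finite X] → [MulAction G Y] → [Finite Y] →
    (X →[G] Y) → obj X → obj Y
  nm : {X Y : Type u} → [MulAction G X] → [Finite X] → [MulAction G Y] → [Finite Y] →
    (X →[G] Y) → obj X → obj Y
  res : {X Y : Type u} → [MulAction G X] → [Finite X] → [MulAction G Y] → [Finite Y] →
    (X →[G] Y) → obj Y → obj X
  -- functoriality
  tr_id : ∀ {X : Type u} [MulAction G X] [Finite X] (a : obj X),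
    tr (MulActionHom.id G : X →[G] X) a = a
  nm_id : ∀ {X : Type u} [MulAction G X] [Finite X] (a : obj X),
    nm (MulActionHom.id G : X →[G] X) a = a
  res_id : ∀ {X : Type u} [MulAction G X] [Finite X] (a : obj X),
    res (MulActionHom.id G : X →[G] X) a = a
  tr_comp : ∀ {X Y Z : Type u} [MulAction G X] [Finite X] [MulAction G Y] [Finite Y]
    [MulAction G Z] [Finite Z] (f : Y →[G] Z) (g : X →[G] Y) (a : obj X),
    tr (f.comp g) a = tr f (tr g a)
  nm_comp : ∀ {X Y Z : Type u} [MulAction G X] [Finite X] [MulAction G Y] [Finite Y]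
    [MulAction G Z] [Finite Z] (f : Y →[G] Z) (g : X →[G] Y) (a : obj X),
    nm (f.comp g) a = nm f (nm g a)
  res_comp : ∀ {X Y Z : Type u} [MulAction G X] [Finite X] [MulAction G Y] [Finite Y]
    [MulAction G Z] [Finite Z] (f : Y →[G] Z) (g : X →[G] Y) (a : obj Z),
    res (f.comp g) a = res g (res f a)
  -- pullback squares
  res_tr : ∀ {P X X' Y : Type u} [MulAction G P] [Finite P] [MulAction G X] [Finite X]
    [MulAction G X'] [Finite X'] [MulAction G Y] [Finite Y]
    (g' : P →[G] X) (f' : P →[G] X') (f : X →[G] Y) (g : X' →[G] Y),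
    IsPullbackSquare g' f' f g → ∀ a : obj X', res f (tr g a) = tr g' (res f' a)
  res_nm : ∀ {P X X' Y : Type u} [MulAction G P] [Finite P] [MulAction G X] [Finite X]
    [MulAction G X'] [Finite X'] [MulAction G Y] [Finite Y]
    (g' : P →[G] X) (f' : P →[G] X') (f : X →[G] Y) (g : X' →[G] Y),
    IsPullbackSquare g' f' f g → ∀ a : obj X', res f (nm g a) = nm g' (res f' a)
  -- exponential diagrams
  nm_tr : ∀ {X Y Z : Type u} [MulAction G X] [Finite X] [MulAction G Y] [Finite Y]
    [MulAction G Z] [Finite Z] (f : Y →[G] Z) (g : X →[G] Y) (a : obj X),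
    nm f (tr g a) = tr (depProdHom f g) (nm (depProdPullHom f g) (res (depProdEval f g) a))
  -- preservation of finite products (which are disjoint unions in `𝒫_G`)
  obj_empty : ∀ (X : Type u) [MulAction G X] [Finite X] [IsEmpty X], Subsingleton (obj X)
  obj_sum : ∀ (X Y : Type u) [MulAction G X] [Finite X] [MulAction G Y] [Finite Y],
    Function.Bijective
      (fun a : obj (X ⊕ Y) => (res (inlHom G X Y) a, res (inrHom G X Y) a))
  -- the ring structure is the induced one
  zero_eq : ∀ {E X : Type u} [MulAction G E] [Finite E] [IsEmpty E] [MulAction G X] [Finite X]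
    (f : E →[G] X) (a : obj E), (0 : obj X) = tr f a
  one_eq : ∀ {E X : Type u} [MulAction G E] [Finite E] [IsEmpty E] [MulAction G X] [Finite X]
    (f : E →[G] X) (a : obj E), (1 : obj X) = nm f a
  add_eq : ∀ {X : Type u} [MulAction G X] [Finite X] (a : obj (X ⊕ X)),
    res (inlHom G X X) a + res (inrHom G X X) a = tr (foldHom G X) a
  mul_eq : ∀ {X : Type u} [MulAction G X] [Finite X] (a : obj (X ⊕ X)),
    res (inlHom G X X) a * res (inrHom G X X) a = nm (foldHom G X) a

attribute [instance] TambaraFunctor.ring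

section

variable {G : Type u} [Group G] [Finite G] (T : TambaraFunctor.{u, v} G)

/-- The level `T(G/H)`. -/
abbrev TambaraFunctor.level (H : Subgroup G) : Type v := T.obj (G ⧸ H)

/-- `tr_H^K : T(G/H) → T(G/K)`. -/
def TambaraFunctor.transfer {H K : Subgroup G} (h : H ≤ K) : T.level H → T.level K :=
  T.tr (quotHom h)

/-- `nm_H^K : T(G/H) → T(G/K)`. -/
def TambaraFunctor.norm {H K : Subgroup G} (h : H ≤ K) : T.level H → T.level K :=
  T.nm (quotHom h)

/-- `res_H^K : T(G/K) → T(G/H)`. -/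
def TambaraFunctor.restrict {H K : Subgroup G} (h : H ≤ K) : T.level K → T.level H :=
  T.res (quotHom h)

/-- `c_{g,H} : T(G/H) → T(G/gHg⁻¹)`. -/
def TambaraFunctor.conj (g : G) (H : Subgroup G) : T.level H → T.level (conjSubgroup g H) :=
  T.tr (conjHom g H)

/-! ### Tambara ideals -/

/-- A family of ideals `I(G/H) ⊆ T(G/H)` is a Tambara ideal if it is closed under restrictions,
transfers, norms and conjugations. -/
structure IsTambaraIdeal (I : (H : Subgroup G) → Ideal (T.level H)) : Prop where
  restrict_mem : ∀ {H K : Subgroup G} (h : H ≤ K) (x : T.level K), x ∈ I K → T.restrict h x ∈ I H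
  transfer_mem : ∀ {H K : Subgroup G} (h : H ≤ K) (x : T.level H), x ∈ I H → T.transfer h x ∈ I K
  norm_mem : ∀ {H K : Subgroup G} (h : H ≤ K) (x : T.level H), x ∈ I H → T.norm h x ∈ I K
  conj_mem : ∀ (g : G) (H : Subgroup G) (x : T.level H),
    x ∈ I H → T.conj g H x ∈ I (conjSubgroup g H)

/-- The ideals of the Tambara functor `T`. -/
@[ext]
structure TambaraIdeal where
  carrier : (H : Subgroup G) → Ideal (T.level H)
  isTambaraIdeal : IsTambaraIdeal T carrier

namespace TambaraIdeal

variable {T}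

/-- Inclusion of ideals, levelwise. -/
instance : LE (TambaraIdeal T) where
  le I J := ∀ H, I.carrier H ≤ J.carrier H

/-- The levelwise intersection of a set of Tambara ideals (the whole of `T` if the set is
empty). -/
def inter (S : Set (TambaraIdeal T)) : TambaraIdeal T where
  carrier H := ⨅ I ∈ S, I.carrier H
  isTambaraIdeal :=
    { restrict_mem := fun h x hx => by
        simp only [Submodule.mem_iInf] at hx ⊢
        exact fun I hI => I.isTambaraIdeal.restrict_mem h x (hx I hI)
      transfer_mem := fun h x hx => by
        simp only [Submodule.mem_iInf] at hx ⊢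
        exact fun I hI => I.isTambaraIdeal.transfer_mem h x (hx I hI)
      norm_mem := fun h x hx => by
        simp only [Submodule.mem_iInf] at hx ⊢
        exact fun I hI => I.isTambaraIdeal.norm_mem h x (hx I hI)
      conj_mem := fun g H x hx => by
        simp only [Submodule.mem_iInf] at hx ⊢
        exact fun I hI => I.isTambaraIdeal.conj_mem g H x (hx I hI) }

/-- The product `IJ`: the intersection of all Tambara ideals that contain all the products
`I(G/H) · J(G/H)`. -/
instance : Mul (TambaraIdeal T) where
  mul I J := inter {K | ∀ H, I.carrier H * J.carrier H ≤ K.carrier H}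

/-- A Tambara ideal is proper if it is not all of `T`. -/
def IsProper (P : TambaraIdeal T) : Prop := ¬ ∀ H, P.carrier H = ⊤

/-- A Tambara ideal `P` is prime if it is proper and `IJ ⊆ P` implies `I ⊆ P` or `J ⊆ P`. -/
def IsPrime (P : TambaraIdeal T) : Prop :=
  P.IsProper ∧ ∀ I J : TambaraIdeal T, I * J ≤ P → I ≤ P ∨ J ≤ P

end TambaraIdeal

/-- `nil(T)`, the intersection of all prime Tambara ideals. -/
def TambaraFunctor.nil : TambaraIdeal T := TambaraIdeal.inter {P | P.IsPrime}

/-- The levelwise nilradical `N(T)`. -/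
def TambaraFunctor.levelwiseNilradical (H : Subgroup G) : Ideal (T.level H) :=
  nilradical (T.level H)

end

end Tambara

/-! Both inclusions rest on a description of generated ideals: the Tambara ideal generated by `x`
consists of the elements `tr_f (nm_v (res_w x) * c)` with `v` surjective. Surjectivity matters
because a norm along a map that misses an orbit is 1 there, so it need not lie in the ideal.

If `x` lies in every prime Tambara ideal, let `Q` be a prime of the ring `T(G/H)`. The elements
whose generated ideal has its level at `H` inside `Q` form a Tambara ideal `core Q`. Closure under
addition is the delicate point and uses the formula `exists_nm_add_eq` for the norm of a sum. Any
ideal not below `core Q` has an element at level `H` outside `Q`, so primality of `Q` passes to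
`core Q` (`core_isPrime`). Hence `x` lies in every prime of `T(G/H)` and is nilpotent.

Conversely, let `normPower x k` be the ideal built from products of `k` norms of restrictions of
`x`. These ideals satisfy `normPower_mul_le`, so a prime containing `normPower x (2 ^ m)` contains
`normPower x 1`, hence `x`. If `x` is nilpotent, a high norm power vanishes (`exists_eq_zero`): over
an orbit, every norm factor is a multiple of one of finitely many nilpotent elements, and the
pigeonhole principle applies. -/

namespace Tambara

/-! ### Equivariant maps, pullbacks and orbits -/

section GSets

variable {G : Type u} [Group G] {A B X X' Y : Type u} [MulAction G A] [MulAction G B]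
  [MulAction G X] [MulAction G X'] [MulAction G Y]

/-- The map out of a sum given by its two components. -/
def sumElimHom (i : A →[G] X) (j : B →[G] X) : (A ⊕ B) →[G] X where
  toFun := Sum.elim i j
  map_smul' g s := by cases s <;> simp [Sum.smul_inl, Sum.smul_inr]

/-- The sum of two equivariant maps. -/
def sumMapHom (i : A →[G] X) (j : B →[G] Y) : (A ⊕ B) →[G] (X ⊕ Y) :=
  sumElimHom ((inlHom G X Y).comp i) ((inrHom G X Y).comp j)

theorem isPullbackSquare_sumMapHom_inl (i : A →[G] X) (j : B →[G] Y) :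
    IsPullbackSquare i (inlHom G A B) (inlHom G X Y) (sumMapHom i j) := by
  refine ⟨fun _ => rfl, ?_⟩
  rintro x (a | b) h
  · exact ⟨a, ⟨(Sum.inl_injective h).symm, rfl⟩, fun a' h' => Sum.inl_injective h'.2⟩
  · cases h

theorem isPullbackSquare_sumMapHom_inr (i : A →[G] X) (j : B →[G] Y) :
    IsPullbackSquare j (inrHom G A B) (inrHom G X Y) (sumMapHom i j) := by
  refine ⟨fun _ => rfl, ?_⟩
  rintro x (a | b) h
  · cases h
  · exact ⟨b, ⟨(Sum.inr_injective h).symm, rfl⟩, fun a' h' => Sum.inr_injective h'.2⟩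

theorem isPullbackSquare_foldHom (f : A →[G] X) :
    IsPullbackSquare (foldHom G A) (sumMapHom f f) f (foldHom G X) := by
  refine ⟨?_, ?_⟩
  · rintro (a | a) <;> rfl
  · rintro a (x | x) h
    · exact ⟨Sum.inl a, ⟨rfl, congrArg Sum.inl h⟩, by
        rintro (b | b) ⟨h1, h2⟩
        · exact congrArg Sum.inl h1
        · cases h2⟩
    · exact ⟨Sum.inr a, ⟨rfl, congrArg Sum.inr h⟩, by
        rintro (b | b) ⟨h1, h2⟩
        · cases h2
        · exact congrArg Sum.inr h1⟩

theorem isPullbackSquare_of_injective (f : A →[G] X) (hf : Function.Injective f) :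
    IsPullbackSquare (MulActionHom.id G) (MulActionHom.id G) f f :=
  ⟨fun _ => rfl, fun a _ h => ⟨a, ⟨rfl, hf h⟩, fun _ h' => h'.1⟩⟩

/-- The fibre product of two maps of `G`-sets. -/
def fiberProd (f : X →[G] Y) (g : X' →[G] Y) : SubMulAction G (X × X') where
  carrier := {p | f p.1 = g p.2}
  smul_mem' c p hp := by
    change f (c • p.1) = g (c • p.2)
    rw [map_smul, map_smul, hp]

/-- The first projection of the fibre product. -/
def fiberProdFst (f : X →[G] Y) (g : X' →[G] Y) : fiberProd f g →[G] X where
  toFun p := p.1.1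
  map_smul' _ _ := rfl

/-- The second projection of the fibre product. -/
def fiberProdSnd (f : X →[G] Y) (g : X' →[G] Y) : fiberProd f g →[G] X' where
  toFun p := p.1.2
  map_smul' _ _ := rfl

theorem isPullbackSquare_fiberProd (f : X →[G] Y) (g : X' →[G] Y) :
    IsPullbackSquare (fiberProdFst f g) (fiberProdSnd f g) f g :=
  ⟨fun p => p.2, fun x x' h => ⟨⟨(x, x'), h⟩, ⟨rfl, rfl⟩, fun _ hp =>
    Subtype.ext (Prod.ext hp.1 hp.2)⟩⟩

theorem fiberProdFst_surjective (f : X →[G] Y) {g : X' →[G] Y} (hg : Function.Surjective g) :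
    Function.Surjective (fiberProdFst f g) := fun x =>
  let ⟨x', h⟩ := hg (f x)
  ⟨⟨(x, x'), h.symm⟩, rfl⟩

theorem bijective_sumElim_compl (S : SubMulAction G X) :
    Function.Bijective (Sum.elim S.subtype (Sᶜ).subtype) := by
  constructor
  · rintro (⟨a, ha⟩ | ⟨a, ha⟩) (⟨b, hb⟩ | ⟨b, hb⟩) h
    · exact congrArg Sum.inl (Subtype.ext h)
    · exact absurd (show a = b from h) (by rintro rfl; exact hb ha)
    · exact absurd (show a = b from h) (by rintro rfl; exact ha hb)
    · exact congrArg Sum.inr (Subtype.ext h)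
  · intro x
    by_cases h : x ∈ S
    · exact ⟨Sum.inl ⟨x, h⟩, rfl⟩
    · exact ⟨Sum.inr ⟨x, h⟩, rfl⟩

/-- A nonempty `G`-set is the sum of an orbit and its complement. -/
theorem exists_orbit_decomposition (X : Type u) [MulAction G X] [Nonempty X] :
    ∃ (L : Subgroup G) (i : (G ⧸ L) →[G] X) (S : SubMulAction G X),
      Function.Bijective (Sum.elim i S.subtype) := by
  obtain ⟨x⟩ := ‹Nonempty X›
  let i : (G ⧸ MulAction.stabilizer G x) →[G] X :=
    { toFun := MulAction.ofQuotientStabilizer G x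
      map_smul' := MulAction.ofQuotientStabilizer_smul G x }
  have hi : Function.Injective i := MulAction.injective_ofQuotientStabilizer G x
  let S : SubMulAction G X :=
    { carrier := {y | y ∉ Set.range i}
      smul_mem' := by
        rintro g y hy ⟨q, hq⟩
        exact hy ⟨g⁻¹ • q, by rw [map_smul, hq, inv_smul_smul]⟩ }
  refine ⟨MulAction.stabilizer G x, i, S, ?_, ?_⟩
  · rintro (a | a) (b | b) h
    · exact congrArg Sum.inl (hi h)
    · exact absurd ⟨a, h⟩ b.2
    · exact absurd ⟨b, h.symm⟩ a.2
    · exact congrArg Sum.inr (Subtype.ext h)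
  · intro y
    by_cases h : y ∈ Set.range i
    · obtain ⟨q, hq⟩ := h
      exact ⟨Sum.inl q, hq⟩
    · exact ⟨Sum.inr ⟨y, h⟩, rfl⟩

theorem quotHom_surjective {H K : Subgroup G} (h : H ≤ K) : Function.Surjective (quotHom h) := by
  intro x
  induction x using QuotientGroup.induction_on with
  | H x => exact ⟨(x : G ⧸ H), rfl⟩

theorem conjHom_bijective (g : G) (H : Subgroup G) : Function.Bijective (conjHom g H) := by
  constructor
  · intro x y h
    induction x using QuotientGroup.induction_on with
    | H x =>
    induction y using QuotientGroup.induction_on with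
    | H y =>
    change ((x * g⁻¹ : G) : G ⧸ conjSubgroup g H) = ((y * g⁻¹ : G) : _) at h
    rw [QuotientGroup.eq] at h ⊢
    obtain ⟨k, hk, hk'⟩ := h
    have : k = x⁻¹ * y := by
      have h1 : g * k * g⁻¹ = g * (x⁻¹ * y) * g⁻¹ := by
        simpa [mul_assoc] using hk'
      exact mul_left_cancel (mul_right_cancel h1)
    exact this ▸ hk
  · intro x
    induction x using QuotientGroup.induction_on with
    | H x =>
    refine ⟨((x * g : G) : G ⧸ H), ?_⟩
    change ((x * g * g⁻¹ : G) : G ⧸ conjSubgroup g H) = _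
    rw [mul_inv_cancel_right]

theorem hom_quotient_surjective {K : Subgroup G} [Nonempty X] (f : X →[G] (G ⧸ K)) :
    Function.Surjective f := by
  intro y
  obtain ⟨x⟩ := ‹Nonempty X›
  obtain ⟨g, hg⟩ := MulAction.exists_smul_eq G (f x) y
  exact ⟨g • x, by rw [map_smul, hg]⟩

/-- Every map between orbits is a conjugation followed by a quotient map. -/
theorem exists_eq_quotHom_comp_conjHom {L K : Subgroup G} (f : (G ⧸ L) →[G] (G ⧸ K)) :
    ∃ (g : G) (h : conjSubgroup g L ≤ K), f = (quotHom h).comp (conjHom g L) := by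
  obtain ⟨g, hg⟩ := QuotientGroup.mk_surjective (f ((1 : G) : G ⧸ L))
  have key : ∀ x : G, f (x : G ⧸ L) = ((x * g : G) : G ⧸ K) := by
    intro x
    have : ((x : G) : G ⧸ L) = x • ((1 : G) : G ⧸ L) := by
      change _ = ((x * 1 : G) : G ⧸ L)
      rw [mul_one]
    rw [this, map_smul, ← hg]
    rfl
  -- The inclusion expresses that `xL ↦ xgK` is well defined. The conjugating element is `g⁻¹`
  -- because `conjHom` multiplies by the inverse on the right.
  have h : conjSubgroup g⁻¹ L ≤ K := by
    rintro _ ⟨l, hl, rfl⟩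
    have h1 : ((1 : G) : G ⧸ L) = ((l : G) : G ⧸ L) := by
      rw [QuotientGroup.eq]
      simpa using hl
    have h2 := congrArg f h1
    rw [key, key, QuotientGroup.eq] at h2
    simpa [mul_assoc] using h2
  refine ⟨g⁻¹, h, ?_⟩
  ext x
  induction x using QuotientGroup.induction_on with
  | H x =>
  rw [key]
  change _ = ((x * g⁻¹⁻¹ : G) : G ⧸ K)
  rw [inv_inv]

theorem conjSubgroup_inv (g : G) (L : Subgroup G) : conjSubgroup g⁻¹ (conjSubgroup g L) = L := by
  ext x
  simp [conjSubgroup, Subgroup.mem_map, mul_assoc]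

theorem conjHom_inv_comp (g : G) (L : Subgroup G) :
    (conjHom g⁻¹ (conjSubgroup g L)).comp (conjHom g L) =
      quotHom (conjSubgroup_inv g L).ge := by
  ext x
  induction x using QuotientGroup.induction_on with
  | H x =>
  change ((x * g⁻¹ * g⁻¹⁻¹ : G) : G ⧸ conjSubgroup g⁻¹ (conjSubgroup g L)) = ((x : G) : _)
  rw [inv_inv, inv_mul_cancel_right]

instance {L : Subgroup G} [Finite X] [Finite G] : Finite ((G ⧸ L) →[G] X) :=
  DFunLike.finite _

theorem foldHom_comp_sumMapHom (i : A →[G] X) (j : B →[G] X) :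
    (foldHom G X).comp (sumMapHom i j) = sumElimHom i j := by
  ext (a | b) <;> rfl

theorem comp_foldHom (f : X →[G] Y) : f.comp (foldHom G X) = sumElimHom f f := by
  ext (a | b) <;> rfl

theorem sumElimHom_bijective {i : A →[G] X} {j : B →[G] X}
    (h : Function.Bijective (Sum.elim i j)) : Function.Bijective (sumElimHom i j) := h

theorem sumElimHom_comp_inl (i : A →[G] X) (j : B →[G] X) :
    (sumElimHom i j).comp (inlHom G A B) = i := rfl

theorem sumElimHom_comp_inr (i : A →[G] X) (j : B →[G] X) :
    (sumElimHom i j).comp (inrHom G A B) = j := rfl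

theorem comp_sumElimHom (f : X →[G] Y) (i : A →[G] X) (j : B →[G] X) :
    f.comp (sumElimHom i j) = sumElimHom (f.comp i) (f.comp j) := by
  ext (a | b) <;> rfl

/-- The identification of `X` with the dependent product along the fold map `Y ⨿ Y → Y` of
`f ⨿ id : X ⨿ Y → Y ⨿ Y`. -/
def frobeniusHom (f : X →[G] Y) :
    X →[G] DepProd (foldHom G Y) (sumMapHom f (MulActionHom.id G : Y →[G] Y)) where
  toFun x :=
    { base := f x
      sec := fun s => Sum.elim (fun _ => Sum.inl x) Sum.inr s.1
      is_section := by
        rintro ⟨y | y, h⟩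
        · exact congrArg Sum.inl h.symm
        · rfl }
  map_smul' g x := by
    refine DepProd.ext' (map_smul f g x) ?_
    rintro (y | y) ha hb
    · rfl
    · exact congrArg Sum.inr (smul_inv_smul g y).symm

/-- A section over the two-point fibre above `y` picks a point of `X` over `y` in the first summand
and has no choice in the second. -/
theorem frobeniusHom_bijective (f : X →[G] Y) : Function.Bijective (frobeniusHom f) := by
  constructor
  · intro x x' h
    have hb : f x = f x' := congrArg DepProd.base h
    have key : ∀ (a b : DepProd (foldHom G Y) (sumMapHom f (MulActionHom.id G : Y →[G] Y))),
        a = b → ∀ s (ha : foldHom G Y s = a.base) (hb : foldHom G Y s = b.base),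
          a.sec ⟨s, ha⟩ = b.sec ⟨s, hb⟩ := by
      rintro a _ rfl s _ _
      rfl
    exact Sum.inl_injective (key _ _ h (Sum.inl (f x)) rfl hb)
  · intro a
    obtain ⟨y, s, hs⟩ := a
    obtain ⟨x, hx⟩ : ∃ x, s ⟨Sum.inl y, rfl⟩ = Sum.inl x := by
      have h := hs ⟨Sum.inl y, rfl⟩
      rcases h' : s ⟨Sum.inl y, rfl⟩ with x | y'
      · exact ⟨x, rfl⟩
      · rw [h'] at h
        cases h
    have hxy : f x = y := by
      have h := hs ⟨Sum.inl y, rfl⟩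
      rw [hx] at h
      exact Sum.inl_injective h
    refine ⟨x, DepProd.ext' hxy ?_⟩
    rintro (y' | y') ha hb
    · obtain rfl : y' = y := hb
      exact hx.symm
    · have h := hs ⟨Sum.inr y', hb⟩
      change Sum.inr y' = s ⟨Sum.inr y', hb⟩
      rcases h' : s ⟨Sum.inr y', hb⟩ with x' | y''
      · rw [h'] at h
        cases h
      · rw [h'] at h
        exact congrArg Sum.inr (Sum.inr_injective h).symm

/-- The pullback of the fold map along `frobeniusHom f` is the fold map of `X`. -/
def frobeniusPullHom (f : X →[G] Y) :
    (X ⊕ X) →[G] DepProdPull (foldHom G Y) (sumMapHom f (MulActionHom.id G : Y →[G] Y)) where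
  toFun s :=
    { point := sumMapHom f f s
      elt := frobeniusHom f (foldHom G X s)
      comm := by rcases s with x | x <;> rfl }
  map_smul' g s := by
    refine DepProdPull.ext (map_smul _ g s) ?_
    change frobeniusHom f (foldHom G X (g • s)) = g • frobeniusHom f (foldHom G X s)
    rw [map_smul, map_smul]

theorem frobeniusPullHom_bijective (f : X →[G] Y) :
    Function.Bijective (frobeniusPullHom f) := by
  constructor
  · intro s t h
    have h1 : sumMapHom f f s = sumMapHom f f t := congrArg DepProdPull.point h
    have h2 := (frobeniusHom_bijective f).1 (congrArg DepProdPull.elt h)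
    rcases s with s | s <;> rcases t with t | t
    · exact congrArg Sum.inl h2
    · cases h1
    · cases h1
    · exact congrArg Sum.inr h2
  · rintro ⟨y | y, a, h⟩
    · obtain ⟨x, rfl⟩ := (frobeniusHom_bijective f).2 a
      exact ⟨Sum.inl x, DepProdPull.ext (congrArg Sum.inl (Eq.symm h)) rfl⟩
    · obtain ⟨x, rfl⟩ := (frobeniusHom_bijective f).2 a
      exact ⟨Sum.inr x, DepProdPull.ext (congrArg Sum.inr (Eq.symm h)) rfl⟩

/-- The sections of the fold map with values in the second summand. -/
def rightSections (f : X →[G] Y) : SubMulAction G (DepProd f (foldHom G X)) where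
  carrier := {d | ∀ y, (d.sec y).isRight}
  smul_mem' g d hd := by
    intro y
    have h := hd ⟨g⁻¹ • y.1, by rw [map_smul, y.2]; exact inv_smul_smul g d.base⟩
    change (g • d.sec _).isRight
    rcases h' : d.sec ⟨g⁻¹ • y.1, _⟩ with x | x
    · rw [h'] at h
      cases h
    · rfl

/-- The part of a `G`-set over `X ⨿ X` that lies over the first summand. -/
def leftPart (k : A →[G] (X ⊕ X)) : SubMulAction G A where
  carrier := {a | (k a).isLeft}
  smul_mem' g a ha := by
    change (k (g • a)).isLeft
    rw [map_smul]
    change (k a).isLeft at ha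
    rcases h : k a with x | x
    · rfl
    · rw [h] at ha
      cases ha

theorem eq_inlHom_comp (k : A →[G] (X ⊕ X)) (hk : ∀ a, (k a).isLeft) :
    k = (inlHom G X X).comp ((foldHom G X).comp k) := by
  ext a
  have h := hk a
  change k a = Sum.inl (foldHom G X (k a))
  rcases h' : k a with x | x
  · rfl
  · rw [h'] at h
    cases h

theorem eq_inrHom_comp (k : A →[G] (X ⊕ X)) (hk : ∀ a, (k a).isRight) :
    k = (inrHom G X X).comp ((foldHom G X).comp k) := by
  ext a
  have h := hk a
  change k a = Sum.inr (foldHom G X (k a))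
  rcases h' : k a with x | x
  · rw [h'] at h
    cases h
  · rfl

/-- Ensures that the exponential rule turns norms along surjections into norms along surjections. -/
theorem depProdPullHom_surjective {f : X →[G] Y} (hf : Function.Surjective f) (g : A →[G] X) :
    Function.Surjective (depProdPullHom f g) := fun d =>
  let ⟨x, hx⟩ := hf d.base
  ⟨⟨x, d, hx⟩, rfl⟩

end GSets
end Tambara

namespace Tambara

/-! ### The ring structure and the structure maps of a Tambara functor -/

namespace TambaraFunctor

section

variable {G : Type u} [Group G] (T : TambaraFunctor.{u, v} G)
  {A B X Y Z : Type u} [MulAction G A] [Finite A] [MulAction G B] [Finite B]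
  [MulAction G X] [Finite X] [MulAction G Y] [Finite Y] [MulAction G Z] [Finite Z]

theorem res_injective (f : X →[G] Y) (hf : Function.Bijective f) :
    Function.Injective (T.res f) := by
  intro a b h
  obtain ⟨g, hl, hr⟩ := Function.bijective_iff_has_inverse.1 hf
  let g' : Y →[G] X := f.inverse g hl hr
  have h1 : f.comp g' = MulActionHom.id G := by
    ext y
    exact hr y
  have h2 := congrArg (T.res g') h
  rwa [← T.res_comp, ← T.res_comp, h1, T.res_id, T.res_id] at h2

theorem res_tr_self (f : X →[G] Y) (hf : Function.Injective f) (a : T.obj X) :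
    T.res f (T.tr f a) = a := by
  rw [T.res_tr _ _ _ _ (isPullbackSquare_of_injective f hf), T.res_id, T.tr_id]

theorem res_nm_self (f : X →[G] Y) (hf : Function.Injective f) (a : T.obj X) :
    T.res f (T.nm f a) = a := by
  rw [T.res_nm _ _ _ _ (isPullbackSquare_of_injective f hf), T.res_id, T.nm_id]

theorem tr_res_self (f : X →[G] Y) (hf : Function.Bijective f) (a : T.obj Y) :
    T.tr f (T.res f a) = a :=
  T.res_injective f hf (T.res_tr_self f hf.1 _)

/-- Along an isomorphism both maps are inverse to restriction. -/
theorem nm_eq_tr (f : X →[G] Y) (hf : Function.Bijective f) (a : T.obj X) :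
    T.nm f a = T.tr f a :=
  T.res_injective f hf (by rw [T.res_tr_self f hf.1, T.res_nm_self f hf.1])

theorem nm_res_self (f : X →[G] Y) (hf : Function.Bijective f) (a : T.obj Y) :
    T.nm f (T.res f a) = a := by
  rw [T.nm_eq_tr f hf, T.tr_res_self f hf]

/-! ### Disjoint unions and compatibility with the ring operations -/

theorem exists_of_sum (a : T.obj A) (b : T.obj B) :
    ∃ z : T.obj (A ⊕ B), T.res (inlHom G A B) z = a ∧ T.res (inrHom G A B) z = b := by
  obtain ⟨z, hz⟩ := (T.obj_sum A B).2 (a, b)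
  exact ⟨z, congrArg Prod.fst hz, congrArg Prod.snd hz⟩

theorem sum_ext {y z : T.obj (A ⊕ B)}
    (h : T.res (inlHom G A B) y = T.res (inlHom G A B) z)
    (h' : T.res (inrHom G A B) y = T.res (inrHom G A B) z) : y = z :=
  (T.obj_sum A B).1 (Prod.ext h h')

theorem res_inl_tr (i : A →[G] X) (j : B →[G] Y) (z : T.obj (A ⊕ B)) :
    T.res (inlHom G X Y) (T.tr (sumMapHom i j) z) = T.tr i (T.res (inlHom G A B) z) :=
  T.res_tr _ _ _ _ (isPullbackSquare_sumMapHom_inl i j) z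

theorem res_inr_tr (i : A →[G] X) (j : B →[G] Y) (z : T.obj (A ⊕ B)) :
    T.res (inrHom G X Y) (T.tr (sumMapHom i j) z) = T.tr j (T.res (inrHom G A B) z) :=
  T.res_tr _ _ _ _ (isPullbackSquare_sumMapHom_inr i j) z

theorem res_inl_nm (i : A →[G] X) (j : B →[G] Y) (z : T.obj (A ⊕ B)) :
    T.res (inlHom G X Y) (T.nm (sumMapHom i j) z) = T.nm i (T.res (inlHom G A B) z) :=
  T.res_nm _ _ _ _ (isPullbackSquare_sumMapHom_inl i j) z

theorem res_inr_nm (i : A →[G] X) (j : B →[G] Y) (z : T.obj (A ⊕ B)) :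
    T.res (inrHom G X Y) (T.nm (sumMapHom i j) z) = T.nm j (T.res (inrHom G A B) z) :=
  T.res_nm _ _ _ _ (isPullbackSquare_sumMapHom_inr i j) z

theorem res_inl_res (i : A →[G] X) (j : B →[G] Y) (z : T.obj (X ⊕ Y)) :
    T.res (inlHom G A B) (T.res (sumMapHom i j) z) = T.res i (T.res (inlHom G X Y) z) := by
  rw [← T.res_comp, ← T.res_comp]
  rfl

theorem res_inr_res (i : A →[G] X) (j : B →[G] Y) (z : T.obj (X ⊕ Y)) :
    T.res (inrHom G A B) (T.res (sumMapHom i j) z) = T.res j (T.res (inrHom G X Y) z) := by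
  rw [← T.res_comp, ← T.res_comp]
  rfl

theorem tr_sumElimHom (i : A →[G] X) (j : B →[G] X) (z : T.obj (A ⊕ B)) :
    T.tr (sumElimHom i j) z =
      T.tr i (T.res (inlHom G A B) z) + T.tr j (T.res (inrHom G A B) z) := by
  rw [← foldHom_comp_sumMapHom, T.tr_comp, ← T.add_eq, T.res_inl_tr, T.res_inr_tr]

theorem nm_sumElimHom (i : A →[G] X) (j : B →[G] X) (z : T.obj (A ⊕ B)) :
    T.nm (sumElimHom i j) z =
      T.nm i (T.res (inlHom G A B) z) * T.nm j (T.res (inrHom G A B) z) := by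
  rw [← foldHom_comp_sumMapHom, T.nm_comp, ← T.mul_eq, T.res_inl_nm, T.res_inr_nm]

/-- The pair `(a, b)` is a single element over `X ⊕ X` whose transfer along the fold map is the sum;
the fold map is natural. The next three lemmas argue in the same way. -/
theorem tr_add (f : X →[G] Y) (a b : T.obj X) : T.tr f (a + b) = T.tr f a + T.tr f b := by
  obtain ⟨z, rfl, rfl⟩ := T.exists_of_sum a b
  rw [T.add_eq, ← T.tr_comp, comp_foldHom, T.tr_sumElimHom]

theorem nm_mul (f : X →[G] Y) (a b : T.obj X) : T.nm f (a * b) = T.nm f a * T.nm f b := by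
  obtain ⟨z, rfl, rfl⟩ := T.exists_of_sum a b
  rw [T.mul_eq, ← T.nm_comp, comp_foldHom, T.nm_sumElimHom]

theorem res_add (f : X →[G] Y) (a b : T.obj Y) : T.res f (a + b) = T.res f a + T.res f b := by
  obtain ⟨z, rfl, rfl⟩ := T.exists_of_sum a b
  rw [T.add_eq, T.res_tr _ _ _ _ (isPullbackSquare_foldHom f), ← T.add_eq, T.res_inl_res,
    T.res_inr_res]

theorem res_mul (f : X →[G] Y) (a b : T.obj Y) : T.res f (a * b) = T.res f a * T.res f b := by
  obtain ⟨z, rfl, rfl⟩ := T.exists_of_sum a b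
  rw [T.mul_eq, T.res_nm _ _ _ _ (isPullbackSquare_foldHom f), ← T.mul_eq, T.res_inl_res,
    T.res_inr_res]

theorem tr_zero (f : X →[G] Y) : T.tr f 0 = 0 := by
  have h := T.tr_add f 0 0
  rwa [add_zero, left_eq_add] at h

theorem res_zero (f : X →[G] Y) : T.res f 0 = 0 := by
  have h := T.res_add f 0 0
  rwa [add_zero, left_eq_add] at h

theorem tr_eq_zero_of_isEmpty [IsEmpty X] (f : X →[G] Y) (a : T.obj X) : T.tr f a = 0 :=
  (T.zero_eq f a).symm

/-- The trivial action on the empty set. -/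
instance : MulAction G PEmpty.{u + 1} where
  smul _ e := e.elim
  one_smul e := e.elim
  mul_smul _ _ e := e.elim

/-- The map out of the empty `G`-set. -/
def emptyHom (G X : Type u) [Group G] [MulAction G X] : PEmpty.{u + 1} →[G] X where
  toFun e := e.elim
  map_smul' _ e := e.elim

theorem nm_one (f : X →[G] Y) : T.nm f 1 = 1 := by
  rw [T.one_eq (emptyHom G X) 0, ← T.nm_comp, ← T.one_eq]

theorem res_one (f : X →[G] Y) : T.res f 1 = 1 := by
  have h : IsPullbackSquare (emptyHom G X) (MulActionHom.id G) f (emptyHom G Y) :=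
    ⟨fun e => e.elim, fun _ e => e.elim⟩
  rw [T.one_eq (emptyHom G Y) 0, T.res_nm _ _ _ _ h, ← T.one_eq]

theorem nm_pow (f : X →[G] Y) (a : T.obj X) (n : ℕ) : T.nm f (a ^ n) = T.nm f a ^ n := by
  induction n with
  | zero => rw [pow_zero, pow_zero, T.nm_one]
  | succ n ih => rw [pow_succ, pow_succ, T.nm_mul, ih]

theorem res_pow (f : X →[G] Y) (a : T.obj Y) (n : ℕ) : T.res f (a ^ n) = T.res f a ^ n := by
  induction n with
  | zero => rw [pow_zero, pow_zero, T.res_one]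
  | succ n ih => rw [pow_succ, pow_succ, T.res_mul, ih]

/-- Zero is a transfer from the empty set, and a map from the empty set has no sections over a
nonempty fibre, so the dependent product is empty. -/
theorem nm_zero (f : X →[G] Y) (hf : Function.Surjective f) : T.nm f 0 = 0 := by
  have : IsEmpty (DepProd f (emptyHom G X)) := ⟨fun a =>
    let ⟨x, hx⟩ := hf a.base
    (a.sec ⟨x, hx⟩).elim⟩
  rw [T.zero_eq (emptyHom G X) 0, T.nm_tr, T.tr_eq_zero_of_isEmpty]

/-! ### Decompositions, Frobenius reciprocity and norms of sums -/

theorem tr_decompose {i : A →[G] X} {j : B →[G] X} (h : Function.Bijective (Sum.elim i j))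
    (f : X →[G] Y) (a : T.obj X) :
    T.tr f a = T.tr (f.comp i) (T.res i a) + T.tr (f.comp j) (T.res j a) := by
  conv_lhs => rw [← T.tr_res_self _ (sumElimHom_bijective h) a]
  rw [← T.tr_comp, comp_sumElimHom, T.tr_sumElimHom, ← T.res_comp, ← T.res_comp,
    sumElimHom_comp_inl, sumElimHom_comp_inr]

theorem nm_decompose {i : A →[G] X} {j : B →[G] X} (h : Function.Bijective (Sum.elim i j))
    (f : X →[G] Y) (a : T.obj X) :
    T.nm f a = T.nm (f.comp i) (T.res i a) * T.nm (f.comp j) (T.res j a) := by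
  conv_lhs => rw [← T.nm_res_self _ (sumElimHom_bijective h) a]
  rw [← T.nm_comp, comp_sumElimHom, T.nm_sumElimHom, ← T.res_comp, ← T.res_comp,
    sumElimHom_comp_inl, sumElimHom_comp_inr]

theorem ext_decompose {i : A →[G] X} {j : B →[G] X} (h : Function.Bijective (Sum.elim i j))
    {a b : T.obj X} (hi : T.res i a = T.res i b) (hj : T.res j a = T.res j b) : a = b := by
  apply T.res_injective _ (sumElimHom_bijective h)
  apply T.sum_ext <;> rwa [← T.res_comp, ← T.res_comp]

/-- The rule for exponential diagrams, with the dependent product replaced by an isomorphic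
`G`-set. -/
theorem nm_tr_of_bijective {P Q : Type u} [MulAction G P] [Finite P] [MulAction G Q] [Finite Q]
    (f : Y →[G] Z) (g : X →[G] Y) (q : Q →[G] Z) (p : P →[G] Q) (e : P →[G] X)
    (φ : Q →[G] DepProd f g) (φ' : P →[G] DepProdPull f g)
    (hφ : Function.Bijective φ) (hφ' : Function.Bijective φ')
    (hq : (depProdHom f g).comp φ = q) (hp : (depProdPullHom f g).comp φ' = φ.comp p)
    (he : (depProdEval f g).comp φ' = e) (a : T.obj X) :
    T.nm f (T.tr g a) = T.tr q (T.nm p (T.res e a)) := by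
  rw [T.nm_tr, ← hq, T.tr_comp, ← T.nm_eq_tr φ hφ, ← T.nm_comp, ← hp, T.nm_comp, ← he,
    T.res_comp, T.nm_res_self φ' hφ']

/-- Frobenius reciprocity. -/
theorem tr_mul (f : X →[G] Y) (a : T.obj X) (b : T.obj Y) :
    T.tr f a * b = T.tr f (a * T.res f b) := by
  obtain ⟨z, rfl, rfl⟩ := T.exists_of_sum a b
  -- The product is the norm along the fold map of the transfer along `f ⨿ id`, so the exponential
  -- rule applies to it.
  have h := T.nm_tr_of_bijective (foldHom G Y) (sumMapHom f (MulActionHom.id G : Y →[G] Y)) f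
    (foldHom G X) (sumMapHom (MulActionHom.id G : X →[G] X) f) (frobeniusHom f)
    (frobeniusPullHom f) (frobeniusHom_bijective f) (frobeniusPullHom_bijective f) rfl rfl
    (by ext (x | x) <;> rfl) z
  rwa [← T.mul_eq, ← T.mul_eq, T.res_inl_tr, T.res_inr_tr, T.res_inl_res, T.res_inr_res, T.tr_id,
    T.res_id] at h

theorem mul_tr (f : X →[G] Y) (a : T.obj X) (b : T.obj Y) :
    b * T.tr f a = T.tr f (T.res f b * a) := by
  rw [mul_comm, T.tr_mul, mul_comm]

theorem tr_mul_tr (f : X →[G] Z) (g : Y →[G] Z) (a : T.obj X) (b : T.obj Y) :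
    T.tr f a * T.tr g b = T.tr (f.comp (fiberProdFst f g))
      (T.res (fiberProdFst f g) a * T.res (fiberProdSnd f g) b) := by
  rw [T.tr_mul, T.res_tr _ _ _ _ (isPullbackSquare_fiberProd f g), T.mul_tr, T.tr_comp]

theorem nm_res_leftPart (p : A →[G] Y) (k : A →[G] (X ⊕ X)) (z : T.obj (X ⊕ X)) :
    T.nm p (T.res k z) = T.nm (p.comp (leftPart k).subtype)
        (T.res ((foldHom G X).comp (k.comp (leftPart k).subtype)) (T.res (inlHom G X X) z)) *
      T.nm (p.comp ((leftPart k)ᶜ).subtype) (T.res ((leftPart k)ᶜ).subtype (T.res k z)) := by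
  have h : k.comp (leftPart k).subtype = (inlHom G X X).comp ((foldHom G X).comp
      (k.comp (leftPart k).subtype)) := eq_inlHom_comp _ fun l => l.2
  rw [T.nm_decompose (bijective_sumElim_compl (leftPart k)), ← T.res_comp (inlHom G X X), ← h,
    ← T.res_comp k (leftPart k).subtype]

/-- The norm of a sum along a surjection. -/
theorem exists_nm_add_eq (f : X →[G] Y) (hf : Function.Surjective f) (a b : T.obj X) :
    ∃ (A : Type u) (_ : MulAction G A) (_ : Finite A) (B : Type u) (_ : MulAction G B)
      (_ : Finite B) (L : Type u) (_ : MulAction G L) (_ : Finite L)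
      (R : Type u) (_ : MulAction G R) (_ : Finite R)
      (q : A →[G] Y) (q' : B →[G] Y) (p : L →[G] A) (p' : R →[G] B) (e : L →[G] X)
      (e' : R →[G] X) (c : T.obj A), Function.Surjective p ∧ Function.Surjective p' ∧
      T.nm f (a + b) = T.tr q (T.nm p (T.res e a) * c) + T.tr q' (T.nm p' (T.res e' b)) := by
  obtain ⟨z, rfl, rfl⟩ := T.exists_of_sum a b
  -- A point of the dependent product is a fibre of `f` with each point coloured left (for `a`) or
  -- right (for `b`). `S` is the all-right part, which contributes the pure norm of `b`. Off `S`
  -- every fibre has a left point, so a norm of `a` along a surjection splits off; `c` is the norm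
  -- over the right-coloured points.
  let S := rightSections f
  let ε := depProdEval f (foldHom G X)
  let π := depProdPullHom f (foldHom G X)
  let kA : fiberProd (Sᶜ).subtype π →[G] (X ⊕ X) := ε.comp (fiberProdSnd (Sᶜ).subtype π)
  let kB : fiberProd S.subtype π →[G] (X ⊕ X) := ε.comp (fiberProdSnd S.subtype π)
  let kL : leftPart kA →[G] (X ⊕ X) := kA.comp (leftPart kA).subtype
  have hB : kB = (inrHom G X X).comp ((foldHom G X).comp kB) := by
    refine eq_inrHom_comp kB ?_
    rintro ⟨⟨⟨d, hd⟩, ⟨x, d', hx⟩⟩, h⟩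
    obtain rfl : d = d' := h
    exact hd ⟨x, hx⟩
  refine ⟨_, inferInstance, inferInstance, _, inferInstance, inferInstance,
    _, inferInstance, inferInstance, _, inferInstance, inferInstance,
    (depProdHom f (foldHom G X)).comp (Sᶜ).subtype, (depProdHom f (foldHom G X)).comp S.subtype,
    (fiberProdFst (Sᶜ).subtype π).comp (leftPart kA).subtype, fiberProdFst S.subtype π,
    (foldHom G X).comp kL, (foldHom G X).comp kB,
    T.nm ((fiberProdFst (Sᶜ).subtype π).comp ((leftPart kA)ᶜ).subtype)
      (T.res ((leftPart kA)ᶜ).subtype (T.res kA z)), ?_,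
    fiberProdFst_surjective _ (depProdPullHom_surjective hf _), ?_⟩
  · rintro ⟨d, hd⟩
    obtain ⟨y, hy⟩ : ∃ y, ¬ (d.sec y).isRight := not_forall.1 hd
    refine ⟨⟨⟨(⟨d, hd⟩, ⟨y.1, d, y.2⟩), rfl⟩, ?_⟩, rfl⟩
    change (d.sec y).isLeft
    rcases h' : d.sec y with x | x
    · rfl
    · rw [h'] at hy
      exact absurd rfl hy
  · rw [T.add_eq, T.nm_tr, add_comm, T.tr_decompose (bijective_sumElim_compl S)]
    have h1 := T.res_nm _ _ _ _ (isPullbackSquare_fiberProd S.subtype π) (T.res ε z)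
    have h2 := T.res_nm _ _ _ _ (isPullbackSquare_fiberProd (Sᶜ).subtype π) (T.res ε z)
    rw [← T.res_comp] at h1 h2
    refine congrArg₂ (· + ·) (congrArg (T.tr _) (h1.trans ?_)) (congrArg (T.tr _) (h2.trans ?_))
    · rw [← T.res_comp, ← hB]
    · exact T.nm_res_leftPart _ kA z

end
end TambaraFunctor
end Tambara

namespace Tambara

section

variable {G : Type u} [Group G] [Finite G] {T : TambaraFunctor.{u, v} G}

/-! ### Tambara ideals and arbitrary maps of orbits -/

namespace TambaraIdeal

variable (I : TambaraIdeal T)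

theorem tr_mem {L K : Subgroup G} (f : (G ⧸ L) →[G] (G ⧸ K)) {a : T.level L}
    (ha : a ∈ I.carrier L) : T.tr f a ∈ I.carrier K := by
  obtain ⟨g, h, rfl⟩ := exists_eq_quotHom_comp_conjHom f
  rw [T.tr_comp]
  exact I.isTambaraIdeal.transfer_mem h _ (I.isTambaraIdeal.conj_mem g L a ha)

theorem nm_mem {L K : Subgroup G} (f : (G ⧸ L) →[G] (G ⧸ K)) {a : T.level L}
    (ha : a ∈ I.carrier L) : T.nm f a ∈ I.carrier K := by
  obtain ⟨g, h, rfl⟩ := exists_eq_quotHom_comp_conjHom f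
  rw [T.nm_comp, T.nm_eq_tr _ (conjHom_bijective g L)]
  exact I.isTambaraIdeal.norm_mem h _ (I.isTambaraIdeal.conj_mem g L a ha)

theorem res_mem {L K : Subgroup G} (f : (G ⧸ L) →[G] (G ⧸ K)) {a : T.level K}
    (ha : a ∈ I.carrier K) : T.res f a ∈ I.carrier L := by
  obtain ⟨g, h, rfl⟩ := exists_eq_quotHom_comp_conjHom f
  rw [T.res_comp]
  -- Restriction along `conjHom g L` is realised by conjugating with `g⁻¹`. This lands at
  -- `g⁻¹(gLg⁻¹)g`, and the restriction along its equality with `L` returns to level `L`.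
  have h1 := I.isTambaraIdeal.restrict_mem (conjSubgroup_inv g L).ge _
    (I.isTambaraIdeal.conj_mem g⁻¹ _ _ (I.isTambaraIdeal.restrict_mem h a ha))
  rw [TambaraFunctor.restrict, ← conjHom_inv_comp, T.res_comp, TambaraFunctor.conj,
    T.res_tr_self _ (conjHom_bijective _ _).1] at h1
  exact h1

/-- One orbit of `D` already gives a factor in the ideal; the norm over the remaining orbits is
absorbed. -/
theorem nm_res_mem {D : Type u} [MulAction G D] [Finite D] {K L : Subgroup G} {a : T.level K}
    (ha : a ∈ I.carrier K) (v : D →[G] (G ⧸ L)) (hv : Function.Surjective v)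
    (w : D →[G] (G ⧸ K)) : T.nm v (T.res w a) ∈ I.carrier L := by
  have : Nonempty D := let ⟨d, _⟩ := hv ((1 : G) : G ⧸ L); ⟨d⟩
  obtain ⟨M, i, S, h⟩ := exists_orbit_decomposition (G := G) D
  rw [T.nm_decompose h, ← T.res_comp w i]
  exact Ideal.mul_mem_right _ _ (I.nm_mem _ (I.res_mem _ ha))

end TambaraIdeal

theorem card_lt_of_orbit_decomposition {X : Type u} [MulAction G X] [Finite X] {L : Subgroup G}
    {i : (G ⧸ L) →[G] X} {S : SubMulAction G X}
    (h : Function.Bijective (Sum.elim i S.subtype)) : Nat.card S < Nat.card X := by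
  rw [← Nat.card_eq_of_bijective _ h, Nat.card_sum]
  have : 0 < Nat.card (G ⧸ L) := Nat.card_pos
  omega

/-- An element is determined by its restrictions to orbits. -/
theorem TambaraFunctor.eq_zero_of_orbits {X : Type u} [MulAction G X] [Finite X] (a : T.obj X)
    (h : ∀ (L : Subgroup G) (i : (G ⧸ L) →[G] X), T.res i a = 0) : a = 0 := by
  induction hn : Nat.card X using Nat.strong_induction_on generalizing X with
  | _ n ih =>
  subst hn
  cases isEmpty_or_nonempty X with
  | inl hX => exact (T.obj_empty X).elim _ _
  | inr hX =>
    obtain ⟨M, i, S, hS⟩ := exists_orbit_decomposition (G := G) X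
    refine T.ext_decompose hS ?_ ?_
    · rw [h, T.res_zero]
    · rw [T.res_zero]
      refine ih _ (card_lt_of_orbit_decomposition hS) _ (fun L j => ?_) rfl
      rw [← T.res_comp, h]

namespace TambaraIdeal

variable (I : TambaraIdeal T)

theorem tr_mem_of_orbits {X : Type u} [MulAction G X] [Finite X] {H : Subgroup G}
    (f : X →[G] (G ⧸ H)) (a : T.obj X)
    (h : ∀ (L : Subgroup G) (i : (G ⧸ L) →[G] X), T.res i a ∈ I.carrier L) :
    T.tr f a ∈ I.carrier H := by
  induction hn : Nat.card X using Nat.strong_induction_on generalizing X with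
  | _ n ih =>
  subst hn
  cases isEmpty_or_nonempty X with
  | inl hX =>
    rw [T.tr_eq_zero_of_isEmpty]
    exact zero_mem _
  | inr hX =>
    obtain ⟨M, i, S, hS⟩ := exists_orbit_decomposition (G := G) X
    rw [T.tr_decompose hS]
    refine add_mem (I.tr_mem _ (h _ _)) ?_
    refine ih _ (card_lt_of_orbit_decomposition hS) _ _ (fun L j => ?_) rfl
    rw [← T.res_comp]
    exact h _ _

/-- Membership is tested on the orbits of `C`, over which the pullback of `v` is still surjective.
-/
theorem tr_nm_res_mem {C D : Type u} [MulAction G C] [Finite C] [MulAction G D] [Finite D]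
    {K H : Subgroup G} {a : T.level K} (ha : a ∈ I.carrier K) (f : C →[G] (G ⧸ H))
    (v : D →[G] C) (hv : Function.Surjective v) (w : D →[G] (G ⧸ K)) (c : T.obj C) :
    T.tr f (T.nm v (T.res w a) * c) ∈ I.carrier H := by
  refine I.tr_mem_of_orbits f _ fun L i => ?_
  rw [T.res_mul, T.res_nm _ _ _ _ (isPullbackSquare_fiberProd i v), ← T.res_comp w]
  exact Ideal.mul_mem_right _ _ (I.nm_res_mem ha _ (fiberProdFst_surjective _ hv) _)

end TambaraIdeal

/-! ### The largest Tambara ideal with a level contained in a given ideal -/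

/-- All the elements at level `H` of the Tambara ideal generated by `a` lie in `Q`. -/
def TambaraFunctor.GeneratesWithin {H : Subgroup G} (Q : Ideal (T.level H)) {X : Type u}
    [MulAction G X] [Finite X] (a : T.obj X) : Prop :=
  ∀ (C : Type u) [MulAction G C] [Finite C] (D : Type u) [MulAction G D] [Finite D]
    (f : C →[G] (G ⧸ H)) (v : D →[G] C) (w : D →[G] X) (c : T.obj C), Function.Surjective v →
    T.tr f (T.nm v (T.res w a) * c) ∈ Q

namespace TambaraFunctor.GeneratesWithin

variable {H : Subgroup G} {Q : Ideal (T.level H)} {X Y : Type u} [MulAction G X] [Finite X]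
  [MulAction G Y] [Finite Y]

theorem zero : GeneratesWithin Q (0 : T.obj X) := by
  intro C _ _ D _ _ f v w c hv
  rw [T.res_zero, T.nm_zero v hv, zero_mul, T.tr_zero]
  exact zero_mem _

theorem add {a b : T.obj X} (ha : GeneratesWithin Q a) (hb : GeneratesWithin Q b) :
    GeneratesWithin Q (a + b) := by
  intro C _ _ D _ _ f v w c hv
  obtain ⟨A, _, _, B, _, _, L, _, _, R, _, _, q, q', p, p', e, e', c', hp, hp', h⟩ :=
    T.exists_nm_add_eq v hv (T.res w a) (T.res w b)
  rw [T.res_add, h, add_mul, T.tr_add, T.tr_mul, T.tr_mul, ← T.tr_comp, ← T.tr_comp,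
    ← T.res_comp, ← T.res_comp, mul_assoc]
  exact add_mem (ha _ _ _ _ _ _ hp) (hb _ _ _ _ _ _ hp')

theorem mul {a : T.obj X} (r : T.obj X) (ha : GeneratesWithin Q a) :
    GeneratesWithin Q (r * a) := by
  intro C _ _ D _ _ f v w c hv
  rw [T.res_mul, T.nm_mul, mul_comm (T.nm v _), mul_assoc]
  exact ha _ _ _ _ _ _ hv

theorem res (g : Y →[G] X) {a : T.obj X} (ha : GeneratesWithin Q a) :
    GeneratesWithin Q (T.res g a) := by
  intro C _ _ D _ _ f v w c hv
  rw [← T.res_comp]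
  exact ha _ _ _ _ _ _ hv

theorem nm (g : X →[G] Y) (hg : Function.Surjective g) {a : T.obj X}
    (ha : GeneratesWithin Q a) : GeneratesWithin Q (T.nm g a) := by
  intro C _ _ D _ _ f v w c hv
  rw [T.res_nm _ _ _ _ (isPullbackSquare_fiberProd w g), ← T.nm_comp]
  exact ha _ _ _ _ _ _ (hv.comp (fiberProdFst_surjective w hg))

/-- The exponential rule moves the transfer outside the norm, and Frobenius reciprocity moves `c`
inside the transfer. -/
theorem tr (g : X →[G] Y) {a : T.obj X} (ha : GeneratesWithin Q a) :
    GeneratesWithin Q (T.tr g a) := by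
  intro C _ _ D _ _ f v w c hv
  rw [T.res_tr _ _ _ _ (isPullbackSquare_fiberProd w g), T.nm_tr, T.tr_mul, ← T.tr_comp,
    ← T.res_comp]
  exact ha _ _ _ _ _ _ (depProdPullHom_surjective hv _)

end TambaraFunctor.GeneratesWithin

/-- The largest Tambara ideal whose level at `H` is contained in `Q`. -/
def TambaraIdeal.core {H : Subgroup G} (Q : Ideal (T.level H)) : TambaraIdeal T where
  carrier _ :=
    { carrier := {a | TambaraFunctor.GeneratesWithin Q a}
      zero_mem' := .zero
      add_mem' := .add
      smul_mem' := fun r _ ha => ha.mul r }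
  isTambaraIdeal :=
    { restrict_mem := fun _ _ hx => TambaraFunctor.GeneratesWithin.res _ hx
      transfer_mem := fun _ _ hx => TambaraFunctor.GeneratesWithin.tr _ hx
      norm_mem := fun h _ hx => TambaraFunctor.GeneratesWithin.nm _ (quotHom_surjective h) hx
      conj_mem := fun _ _ _ hx => TambaraFunctor.GeneratesWithin.tr _ hx }

theorem TambaraIdeal.core_le {H : Subgroup G} (Q : Ideal (T.level H)) :
    (core Q).carrier H ≤ Q := by
  intro a ha
  have h := ha (G ⧸ H) (G ⧸ H) (MulActionHom.id G) (MulActionHom.id G) (MulActionHom.id G) 1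
    Function.surjective_id
  rwa [T.res_id, T.nm_id, mul_one, T.tr_id] at h

/-! ### Products of Tambara ideals and primality of the core -/

theorem TambaraIdeal.mul_carrier_le (I J : TambaraIdeal T) (H : Subgroup G) :
    I.carrier H * J.carrier H ≤ (I * J).carrier H := by
  change _ ≤ ⨅ K ∈ {K : TambaraIdeal T | ∀ H, I.carrier H * J.carrier H ≤ K.carrier H},
    K.carrier H
  exact le_iInf₂ fun K hK => hK H

theorem TambaraIdeal.mul_le {I J P : TambaraIdeal T}
    (h : ∀ H, I.carrier H * J.carrier H ≤ P.carrier H) : I * J ≤ P := by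
  intro H
  change ⨅ K ∈ {K : TambaraIdeal T | ∀ H, I.carrier H * J.carrier H ≤ K.carrier H},
    K.carrier H ≤ _
  exact iInf₂_le P h

/-- This is the maximality of `core Q`: every element tested by `GeneratesWithin` on members of `I`
lies in `I` at level `H`. -/
theorem TambaraIdeal.exists_mem_of_not_le_core {H : Subgroup G} {Q : Ideal (T.level H)}
    {I : TambaraIdeal T} (h : ¬ I ≤ core Q) : ∃ a ∈ I.carrier H, a ∉ Q := by
  by_contra! h'
  exact h fun K a ha C _ _ D _ _ f v w c hv => h' _ (I.tr_nm_res_mem ha f v hv w c)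

theorem TambaraIdeal.core_isPrime {H : Subgroup G} (Q : Ideal (T.level H)) [hQ : Q.IsPrime] :
    (core Q).IsPrime := by
  refine ⟨fun h => hQ.ne_top (top_le_iff.1 (h H ▸ core_le Q)), fun I J hIJ => ?_⟩
  by_contra! h
  obtain ⟨a, ha, ha'⟩ := exists_mem_of_not_le_core h.1
  obtain ⟨b, hb, hb'⟩ := exists_mem_of_not_le_core h.2
  rcases hQ.mem_or_mem (core_le Q (hIJ H (mul_carrier_le I J H (Ideal.mul_mem_mul ha hb)))) with
    h | h
  · exact ha' h
  · exact hb' h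

theorem TambaraIdeal.isNilpotent_of_mem_primes {H : Subgroup G} {x : T.level H}
    (h : ∀ P : TambaraIdeal T, P.IsPrime → x ∈ P.carrier H) : IsNilpotent x := by
  rw [nilpotent_iff_mem_prime]
  exact fun Q hQ => core_le Q (h _ (core_isPrime Q))

end
end Tambara

namespace Tambara

/-! ### Powers of a principal Tambara ideal -/

section

variable {G : Type u} [Group G] {T : TambaraFunctor.{u, v} G}
  {X : Type u} [MulAction G X] [Finite X]

/-- `a` is a multiple of a product of `k` norms along surjections of restrictions of `x`. -/
def TambaraFunctor.NormMultiple (x : T.obj X) :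
    ℕ → (C : Type u) → [MulAction G C] → [Finite C] → T.obj C → Prop
  | 0, _, _, _, _ => True
  | k + 1, C, _, _, a => ∃ (D : Type u) (_ : MulAction G D) (_ : Finite D) (v : D →[G] C)
      (w : D →[G] X) (b : T.obj C), Function.Surjective v ∧ NormMultiple x k C b ∧
        a = T.nm v (T.res w x) * b

namespace TambaraFunctor.NormMultiple

variable {x : T.obj X} {C C' : Type u} [MulAction G C] [Finite C] [MulAction G C'] [Finite C']
  {k : ℕ}

theorem mul_left {a : T.obj C} (ha : NormMultiple x k C a) (c : T.obj C) :
    NormMultiple x k C (c * a) := by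
  induction k generalizing a with
  | zero => trivial
  | succ k ih =>
    obtain ⟨D, _, _, v, w, b, hv, hb, rfl⟩ := ha
    exact ⟨D, _, ‹_›, v, w, c * b, hv, ih hb, mul_left_comm _ _ _⟩

theorem mul {j : ℕ} {a b : T.obj C} (ha : NormMultiple x j C a) (hb : NormMultiple x k C b) :
    NormMultiple x (j + k) C (a * b) := by
  induction j generalizing a with
  | zero =>
    rw [zero_add]
    exact hb.mul_left a
  | succ j ih =>
    obtain ⟨D, _, _, v, w, a, hv, ha, rfl⟩ := ha
    rw [Nat.succ_add]
    exact ⟨D, _, ‹_›, v, w, a * b, hv, ih ha, mul_assoc _ _ _⟩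

theorem nm (f : C →[G] C') (hf : Function.Surjective f) {a : T.obj C}
    (ha : NormMultiple x k C a) : NormMultiple x k C' (T.nm f a) := by
  induction k generalizing a with
  | zero => trivial
  | succ k ih =>
    obtain ⟨D, _, _, v, w, b, hv, hb, rfl⟩ := ha
    exact ⟨D, _, ‹_›, f.comp v, w, T.nm f b, hf.comp hv, ih hb, by rw [T.nm_mul, T.nm_comp]⟩

theorem res (f : C' →[G] C) {a : T.obj C} (ha : NormMultiple x k C a) :
    NormMultiple x k C' (T.res f a) := by
  induction k generalizing a with
  | zero => trivial
  | succ k ih =>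
    obtain ⟨D, _, _, v, w, b, hv, hb, rfl⟩ := ha
    exact ⟨fiberProd f v, inferInstance, inferInstance, fiberProdFst f v,
      w.comp (fiberProdSnd f v), T.res f b, fiberProdFst_surjective f hv, ih hb, by
        rw [T.res_mul, T.res_comp, T.res_nm _ _ _ _ (isPullbackSquare_fiberProd f v)]⟩

/-- Makes sums of transfers from different `G`-sets into one transfer, so that `normPower` is closed
under addition. -/
theorem of_sum {z : T.obj (C ⊕ C')} (h : NormMultiple x k C (T.res (inlHom G C C') z))
    (h' : NormMultiple x k C' (T.res (inrHom G C C') z)) : NormMultiple x k (C ⊕ C') z := by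
  induction k generalizing z with
  | zero => trivial
  | succ k ih =>
    obtain ⟨D, _, _, v, w, b, hv, hb, h⟩ := h
    obtain ⟨D', _, _, v', w', b', hv', hb', h'⟩ := h'
    obtain ⟨y, rfl, rfl⟩ := T.exists_of_sum b b'
    refine ⟨D ⊕ D', inferInstance, inferInstance, sumMapHom v v', sumElimHom w w', y, ?_,
      ih hb hb', ?_⟩
    · rintro (c | c)
      · obtain ⟨d, rfl⟩ := hv c
        exact ⟨Sum.inl d, rfl⟩
      · obtain ⟨d, rfl⟩ := hv' c
        exact ⟨Sum.inr d, rfl⟩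
    · refine T.sum_ext ?_ ?_
      · rw [h, T.res_mul, T.res_inl_nm, ← T.res_comp _ (inlHom G D D'), sumElimHom_comp_inl]
      · rw [h', T.res_mul, T.res_inr_nm, ← T.res_comp _ (inrHom G D D'), sumElimHom_comp_inr]

theorem zero_empty (x : T.obj X) (k : ℕ) :
    NormMultiple x k PEmpty.{u + 1} (0 : T.obj PEmpty.{u + 1}) := by
  induction k with
  | zero => trivial
  | succ k ih =>
    exact ⟨PEmpty, inferInstance, inferInstance, MulActionHom.id G, emptyHom G X, 0,
      Function.surjective_id, ih, (mul_zero _).symm⟩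

theorem of_le {j : ℕ} (hjk : j ≤ k) {a : T.obj C} (ha : NormMultiple x k C a) :
    NormMultiple x j C a := by
  induction k generalizing a j with
  | zero =>
    obtain rfl := Nat.le_zero.1 hjk
    trivial
  | succ k ih =>
    obtain ⟨D, _, _, v, w, b, hv, hb, rfl⟩ := ha
    cases j with
    | zero => trivial
    | succ j => exact ⟨D, _, ‹_›, v, w, b, hv, ih (Nat.le_of_succ_le_succ hjk) hb, rfl⟩

/-! ### Vanishing of high norm powers of a nilpotent element -/

section Vanishing

variable [Finite G]

/-- The norms of restrictions of `x` to `G/K`, coming from orbits. -/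
def orbitNorm (x : T.obj X) (K : Subgroup G)
    (t : Σ L : Subgroup G, ((G ⧸ L) →[G] (G ⧸ K)) × ((G ⧸ L) →[G] X)) : T.level K :=
  T.nm t.2.1 (T.res t.2.2 x)

/-- Each norm along a surjection onto `G ⧸ K` has an orbit norm as a factor. The index type is
finite, so factors can be collected with multiplicities `m`. -/
theorem exists_eq_prod_orbitNorm {K : Subgroup G}
    [Fintype (Σ L : Subgroup G, ((G ⧸ L) →[G] (G ⧸ K)) × ((G ⧸ L) →[G] X))] {a : T.level K}
    (ha : NormMultiple x k (G ⧸ K) a) :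
    ∃ (m : (Σ L : Subgroup G, ((G ⧸ L) →[G] (G ⧸ K)) × ((G ⧸ L) →[G] X)) → ℕ) (c : T.level K),
      ∑ t, m t = k ∧ a = (∏ t, orbitNorm x K t ^ m t) * c := by
  classical
  induction k generalizing a with
  | zero => exact ⟨0, a, by simp, by simp⟩
  | succ k ih =>
    obtain ⟨D, _, _, v, w, b, hv, hb, rfl⟩ := ha
    obtain ⟨m, c, hm, rfl⟩ := ih hb
    have : Nonempty D := let ⟨d, _⟩ := hv ((1 : G) : G ⧸ K); ⟨d⟩
    obtain ⟨L, i, S, h⟩ := exists_orbit_decomposition (G := G) D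
    rw [T.nm_decompose h, ← T.res_comp w i]
    refine ⟨m + Pi.single ⟨L, v.comp i, w.comp i⟩ 1,
      T.nm (v.comp S.subtype) (T.res S.subtype (T.res w x)) * c, ?_, ?_⟩
    · simp [Finset.sum_add_distrib, hm]
    · have : ∏ t, orbitNorm x K t ^ (Pi.single ⟨L, v.comp i, w.comp i⟩ 1 : _ → ℕ) t =
          T.nm (v.comp i) (T.res (w.comp i) x) := by
        rw [Finset.prod_eq_single ⟨L, v.comp i, w.comp i⟩]
        · rw [Pi.single_eq_same, pow_one]
          rfl
        · intro t _ ht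
          rw [Pi.single_eq_of_ne ht, pow_zero]
        · intro h
          exact absurd (Finset.mem_univ _) h
      simp only [Pi.add_apply, pow_add, Finset.prod_mul_distrib, this]
      ring

theorem exists_eq_zero_of_orbit (hx : IsNilpotent x) (K : Subgroup G) :
    ∃ N, ∀ a : T.level K, NormMultiple x N (G ⧸ K) a → a = 0 := by
  obtain ⟨n, hn⟩ := hx
  have := Fintype.ofFinite (Σ L : Subgroup G, ((G ⧸ L) →[G] (G ⧸ K)) × ((G ⧸ L) →[G] X))
  refine ⟨Fintype.card (Σ L : Subgroup G, ((G ⧸ L) →[G] (G ⧸ K)) × ((G ⧸ L) →[G] X)) * n + 1,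
    fun a ha => ?_⟩
  obtain ⟨m, c, hm, rfl⟩ := exists_eq_prod_orbitNorm ha
  -- Pigeonhole: were all multiplicities at most `n`, their sum could not exceed the number of orbit
  -- norms times `n`.
  obtain ⟨t, ht⟩ : ∃ t, n < m t := by
    by_contra! h
    have := Finset.sum_le_card_nsmul Finset.univ m n fun t _ => h t
    rw [hm, smul_eq_mul, Finset.card_univ] at this
    omega
  have hz : orbitNorm x K t ^ m t = 0 := by
    have : orbitNorm x K t ^ n = 0 := by
      rw [orbitNorm, ← T.nm_pow, ← T.res_pow, hn, T.res_zero,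
        T.nm_zero _ (hom_quotient_surjective _)]
    exact pow_eq_zero_of_le ht.le this
  rw [Finset.prod_eq_zero (Finset.mem_univ t) hz, zero_mul]

/-- Vanishing is detected on orbits, and `G` has finitely many subgroups, so the sum of the bounds
for the single orbits is uniform in `C`. -/
theorem exists_eq_zero (hx : IsNilpotent x) :
    ∃ N, ∀ (C : Type u) [MulAction G C] [Finite C] (a : T.obj C),
      NormMultiple x N C a → a = 0 := by
  choose N hN using exists_eq_zero_of_orbit (T := T) hx
  have := Fintype.ofFinite (Subgroup G)
  refine ⟨∑ K, N K, fun C _ _ a ha => T.eq_zero_of_orbits a fun L i => ?_⟩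
  exact hN L _ ((ha.res i).of_le (Finset.single_le_sum (fun _ _ => Nat.zero_le _)
    (Finset.mem_univ L)))

end Vanishing

end TambaraFunctor.NormMultiple

end

/-! ### Norm powers as Tambara ideals and the main theorem -/

section

variable {G : Type u} [Group G] [Finite G] {T : TambaraFunctor.{u, v} G}
  {X : Type u} [MulAction G X] [Finite X]

namespace TambaraIdeal

open TambaraFunctor

/-- The Tambara ideal of transfers of multiples of products of `k` norms of restrictions of
`x`. -/
def normPower (x : T.obj X) (k : ℕ) : TambaraIdeal T where
  carrier K :=
    { carrier := {a | ∃ (C : Type u) (_ : MulAction G C) (_ : Finite C) (f : C →[G] (G ⧸ K))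
        (b : T.obj C), NormMultiple x k C b ∧ a = T.tr f b}
      zero_mem' := ⟨PEmpty, inferInstance, inferInstance, emptyHom G _, 0,
        NormMultiple.zero_empty x k, (T.tr_zero _).symm⟩
      add_mem' := by
        rintro _ _ ⟨C, _, _, f, b, hb, rfl⟩ ⟨C', _, _, f', b', hb', rfl⟩
        obtain ⟨z, rfl, rfl⟩ := T.exists_of_sum b b'
        exact ⟨C ⊕ C', inferInstance, inferInstance, sumElimHom f f', z, .of_sum hb hb',
          (T.tr_sumElimHom f f' z).symm⟩
      smul_mem' := by
        rintro r _ ⟨C, _, _, f, b, hb, rfl⟩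
        exact ⟨C, _, ‹_›, f, T.res f r * b, hb.mul_left _, T.mul_tr f b r⟩ }
  isTambaraIdeal :=
    { restrict_mem := by
        rintro H K h _ ⟨C, _, _, f, b, hb, rfl⟩
        exact ⟨_, inferInstance, inferInstance, fiberProdFst (quotHom h) f, _,
          hb.res (fiberProdSnd (quotHom h) f),
          T.res_tr _ _ _ _ (isPullbackSquare_fiberProd _ f) b⟩
      transfer_mem := by
        rintro H K h _ ⟨C, _, _, f, b, hb, rfl⟩
        exact ⟨C, _, ‹_›, (quotHom h).comp f, b, hb, (T.tr_comp _ f b).symm⟩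
      norm_mem := by
        rintro H K h _ ⟨C, _, _, f, b, hb, rfl⟩
        exact ⟨_, inferInstance, inferInstance, depProdHom (quotHom h) f, _,
          (hb.res (depProdEval (quotHom h) f)).nm _
            (depProdPullHom_surjective (quotHom_surjective h) f), T.nm_tr _ f b⟩
      conj_mem := by
        rintro g H _ ⟨C, _, _, f, b, hb, rfl⟩
        exact ⟨C, _, ‹_›, (conjHom g H).comp f, b, hb, (T.tr_comp _ f b).symm⟩ }

/-- A product of two transfers is a transfer from the fibre product, where the norm factors of both
restrictions accumulate. -/
theorem normPower_mul_le (x : T.obj X) (j k : ℕ) :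
    normPower x j * normPower x k ≤ normPower x (j + k) := by
  refine mul_le fun H => Ideal.mul_le.2 ?_
  rintro _ ⟨C, _, _, f, a, ha, rfl⟩ _ ⟨C', _, _, f', b, hb, rfl⟩
  exact ⟨_, inferInstance, inferInstance, f.comp (fiberProdFst f f'), _,
    (ha.res (fiberProdFst f f')).mul (hb.res (fiberProdSnd f f')), T.tr_mul_tr f f' a b⟩

theorem mem_normPower_one {H : Subgroup G} (x : T.level H) : x ∈ (normPower x 1).carrier H :=
  ⟨G ⧸ H, inferInstance, inferInstance, MulActionHom.id G, x,
    ⟨G ⧸ H, inferInstance, inferInstance, MulActionHom.id G, MulActionHom.id G, 1,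
      Function.surjective_id, trivial, by rw [T.res_id, T.nm_id, mul_one]⟩, (T.tr_id x).symm⟩

theorem IsPrime.normPower_one_le {P : TambaraIdeal T} (hP : P.IsPrime) (x : T.obj X) (m : ℕ)
    (h : normPower x (2 ^ m) ≤ P) : normPower x 1 ≤ P := by
  induction m with
  | zero => exact h
  | succ m ih =>
    rw [pow_succ, mul_two] at h
    have h' : normPower x (2 ^ m) * normPower x (2 ^ m) ≤ P := fun H =>
      (normPower_mul_le x _ _ H).trans (h H)
    exact ih ((hP.2 _ _ h').elim id id)

theorem IsPrime.mem_of_isNilpotent {P : TambaraIdeal T} (hP : P.IsPrime) {H : Subgroup G}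
    {x : T.level H} (hx : IsNilpotent x) : x ∈ P.carrier H := by
  obtain ⟨N, hN⟩ := NormMultiple.exists_eq_zero hx
  -- Since `N < 2 ^ N`, the ideal `normPower x (2 ^ N)` is zero and so lies in `P`.
  refine hP.normPower_one_le x N ?_ H (mem_normPower_one x)
  rintro K _ ⟨C, _, _, f, b, hb, rfl⟩
  rw [hN C b (hb.of_le Nat.lt_two_pow_self.le), T.tr_zero]
  exact zero_mem _

theorem mem_primes_iff_isNilpotent {H : Subgroup G} (x : T.level H) :
    (∀ P : TambaraIdeal T, P.IsPrime → x ∈ P.carrier H) ↔ IsNilpotent x :=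
  ⟨isNilpotent_of_mem_primes, fun hx _ hP => hP.mem_of_isNilpotent hx⟩

end TambaraIdeal

theorem TambaraFunctor.nil_carrier (T : TambaraFunctor.{u, v} G) :
    T.nil.carrier = T.levelwiseNilradical := by
  ext H x
  change x ∈ ⨅ P ∈ {P : TambaraIdeal T | P.IsPrime}, P.carrier H ↔ x ∈ nilradical (T.level H)
  rw [mem_nilradical, ← TambaraIdeal.mem_primes_iff_isNilpotent]
  simp only [Submodule.mem_iInf, Set.mem_ofPred_eq]

end

end Tambara

theorem theoremA {G : Type u} [Group G] [Finite G] (T : Tambara.TambaraFunctor.{u, v} G) :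
    T.nil.carrier = T.levelwiseNilradical ∧
    (∀ (H : Subgroup G) (x : T.level H),
      (∀ P : Tambara.TambaraIdeal T, P.IsPrime → x ∈ P.carrier H) ↔ IsNilpotent x) ∧
    Tambara.IsTambaraIdeal T T.levelwiseNilradical :=
  ⟨T.nil_carrier, fun _ => Tambara.TambaraIdeal.mem_primes_iff_isNilpotent,
    T.nil_carrier ▸ T.nil.isTambaraIdeal⟩
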